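/- Let $R$ be a commutative noetherian ring and let $A$ be an associative unital $R$-algebra, not necessarily commutative, that is finitely generated as an $R$-module. Let $\varphi\colon R\to A$ be the structure homomorphism. For a ring $B$, a complex $\mathbf P=(\cdots\to P_1\xrightarrow{\partial_1}P_0\xrightarrow{\partial_0}P_{-1}\to\cdots)$ of projective left $B$-modules is called totally acyclic if $\mathbf P$ is acyclic and $\operatorname{Hom}_B(\mathbf P,Q)$ is acyclic for every projective left $B$-module $Q$; a left $B$-module is Gorenstein projective if it is isomorphic to the image of $\partial_0$ for some totally acyclic complex $\mathbf P$ of projective left $B$-modules. Right $B$-modules are left modules over the opposite ring $B^{\mathrm{op}}$. Assume that $\varphi$ is a Frobenius extension, that is, $A$ is a finitely generated projective $R$-module and there is an isomorphism $A\cong\operatorname{Hom}_R(A,R)$ of left $A$-modules and of right $R$-modules, where $(af)(y)=f(ya)$ and $(fr)(y)=f(y)r$ for $f\in\operatorname{Hom}_R(A,R)$, $a,y\in A$, $r\in R$. Then $\varphi$ has ascent and descent of Gorenstein projective property, that is: 1. a finitely generated left $A$-module is Gorenstein projective over $A$ if and only if it is Gorenstein projective as an $R$-module by restriction of scalars along $\varphi$;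 2. a finitely generated right $A$-module is Gorenstein projective over $A^{\mathrm{op}}$ if and only if it is Gorenstein projective over $R^{\mathrm{op}}$ by restriction of scalars along $\varphi$. -/

import Mathlib

open CategoryTheory

universe u

/-- A complex of projective left `A`-modules `⋯ ⟶ P₁ ⟶ P₀ ⟶ P₋₁ ⟶ ⋯` is totally acyclic if it is
acyclic and the complex of abelian groups `Hom_A(P, Q)` is acyclic for every projective
`A`-module `Q`. -/
structure IsTotallyAcyclic {A : Type u} [Ring A] (P : ChainComplex (ModuleCat.{u} A) ℤ) :
    Prop where
  projective : ∀ i : ℤ, Module.Projective A (P.X i)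
  acyclic : P.Acyclic
  hom_acyclic : ∀ Q : ModuleCat.{u} A, Module.Projective A Q →
    (((preadditiveYoneda.obj Q).mapHomologicalComplex _).obj P.op).Acyclic

/-- A left `A`-module is Gorenstein projective if it is isomorphic to the image of
`∂₀ : P₀ ⟶ P₋₁` for some totally acyclic complex `P` of projective `A`-modules. -/
def IsGorensteinProjective (A : Type u) [Ring A] (M : Type u) [AddCommGroup M] [Module A M] :
    Prop :=
  ∃ P : ChainComplex (ModuleCat.{u} A) ℤ, IsTotallyAcyclic P ∧
    Nonempty (M ≃ₗ[A] LinearMap.range (P.d 0 (-1)).hom)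

/-- A ring homomorphism `φ : S → A` is a Frobenius extension if `A` is a finitely generated
projective left `S`-module and `A ≅ Hom_S(A, S)` both as left `A`-modules and as right
`S`-modules. Here `S` acts on the left of `A` by `s • x = φ s * x`, `S` acts on the right of `A`
by `x ↦ x * φ s`, and the actions on `f ∈ Hom_S(A, S)` are `(a • f) y = f (y * a)` and
`(f • s) y = f y * s`. -/
def IsFrobeniusExtension {S A : Type u} [Ring S] [Ring A] (φ : S →+* A) : Prop :=
  letI : Module S A := φ.toModule
  Module.Finite S A ∧ Module.Projective S A ∧
    ∃ e : A ≃+ (A →ₗ[S] S),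
      (∀ a x y : A, e (a * x) y = e x (y * a)) ∧
      (∀ (x : A) (s : S) (y : A), e (x * φ s) y = e x y * s)

/-- Ascent and descent of Gorenstein projective property along `φ : R → A`: a finitely generated
left `A`-module is Gorenstein projective over `A` if and only if it is so over `R`, and a finitely
generated right `A`-module (a left module over `Aᵐᵒᵖ`) is Gorenstein projective over `Aᵐᵒᵖ` if and
only if it is so over `Rᵐᵒᵖ`, the scalars being restricted along `φ`, resp. along the opposite
homomorphism `Rᵐᵒᵖ → Aᵐᵒᵖ`. -/
def HasAscentDescentGorensteinProjective {R A : Type u} [Ring R] [Ring A] (φ : R →+* A) : Prop :=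
  (∀ M : ModuleCat.{u} A, Module.Finite A M →
    (IsGorensteinProjective A M ↔
      IsGorensteinProjective R ((ModuleCat.restrictScalars φ).obj M))) ∧
  (∀ M : ModuleCat.{u} Aᵐᵒᵖ, Module.Finite Aᵐᵒᵖ M →
    (IsGorensteinProjective Aᵐᵒᵖ M ↔
      IsGorensteinProjective Rᵐᵒᵖ ((ModuleCat.restrictScalars (RingHom.op φ)).obj M)))

/-! A totally acyclic complex is a bi-infinite splice of short exact sequences, so Gorenstein
projectivity can be treated coinductively. A module is Gorenstein projective iff it lies in some
class whose members have vanishing Ext¹ into projectives, embed into a projective with cokernel in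
the class, and are covered by a projective with kernel in the class (`isGorensteinProjective_iff`).
Membership is proved by exhibiting such a class; closure under extensions and retracts, and through
Schanuel's trick under syzygies and suitable cosyzygies, follows.

The Frobenius isomorphism gives a trace form with dual bases, by which A ⊗ F is coinduced as well as
induced: an R-map X → F lifts to an A-map X → A ⊗ F (`exists_coinduced_lift`). Restriction and A ⊗ -
both preserve projectives, so Ext¹-vanishing passes both ways. Syzygies and cosyzygies over A
restrict to ones over R. Conversely, an R-embedding X → P lifts to an A-embedding X → A ⊗ P, whose
cokernel stays Gorenstein projective over R by the dual Schanuel argument. Right modules are covered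
by the opposite Frobenius system. -/

section ShortExact

/-! ### Short exact sequences and Ext¹ as an extension property -/

variable {A : Type u} [Ring A]

/-- `0 ⟶ U ⟶ V ⟶ W ⟶ 0` is a short exact sequence of modules. -/
structure IsShortExact {U V W : Type u} [AddCommGroup U] [AddCommGroup V] [AddCommGroup W]
    [Module A U] [Module A V] [Module A W] (f : U →ₗ[A] V) (g : V →ₗ[A] W) : Prop where
  injective : Function.Injective f
  exact : ∀ v, g v = 0 ↔ ∃ u, f u = v
  surjective : Function.Surjective g

/-- `Ext¹(M, Q) = 0` for all projective modules `Q`, in terms of extending maps: for every short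
exact sequence `0 ⟶ U ⟶ V ⟶ M ⟶ 0`, every map `U ⟶ Q` extends to `V`. -/
def ExtVanishesOnProjectives (A : Type u) [Ring A] (M : Type u) [AddCommGroup M] [Module A M] :
    Prop :=
  ∀ (U V Q : Type u) [AddCommGroup U] [AddCommGroup V] [AddCommGroup Q]
    [Module A U] [Module A V] [Module A Q] (f : U →ₗ[A] V) (g : V →ₗ[A] M) (q : U →ₗ[A] Q),
    IsShortExact f g → Module.Projective A Q → ∃ h : V →ₗ[A] Q, ∀ u, h (f u) = q u

variable {U V W : Type u} [AddCommGroup U] [AddCommGroup V] [AddCommGroup W]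
    [Module A U] [Module A V] [Module A W]

lemma IsShortExact.comp_apply {f : U →ₗ[A] V} {g : V →ₗ[A] W} (h : IsShortExact f g) (u : U) :
    g (f u) = 0 :=
  (h.exact _).2 ⟨u, rfl⟩

lemma isShortExact_mkQ {f : U →ₗ[A] V} (hf : Function.Injective f) :
    IsShortExact f (LinearMap.range f).mkQ :=
  ⟨hf, fun v => by simp, Submodule.mkQ_surjective _⟩

lemma isShortExact_subtype {g : V →ₗ[A] W} (hg : Function.Surjective g) :
    IsShortExact (LinearMap.ker g).subtype g :=
  ⟨Subtype.val_injective, fun v => by simp, hg⟩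

lemma linearMap_prod_apply (f : U →ₗ[A] V) (g : U →ₗ[A] W) (u : U) : f.prod g u = (f u, g u) :=
  rfl

/-- A linear map vanishing on the kernel of a surjection factors through it. -/
lemma exists_factor_of_surjective {X : Type*} [AddCommGroup X] [Module A X] {s : V →ₗ[A] W}
    (hs : Function.Surjective s) (t : V →ₗ[A] X) (h : ∀ v, s v = 0 → t v = 0) :
    ∃ g : W →ₗ[A] X, ∀ v, g (s v) = t v := by
  refine ⟨(LinearMap.ker s).liftQ t (fun v hv => h v (LinearMap.mem_ker.1 hv)) ∘ₗ
    (s.quotKerEquivOfSurjective hs).symm.toLinearMap, fun v => ?_⟩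
  have : (s.quotKerEquivOfSurjective hs).symm (s v) = Submodule.Quotient.mk v := by
    rw [LinearEquiv.symm_apply_eq]; rfl
  simp only [LinearMap.comp_apply, LinearEquiv.coe_coe, this]
  exact Submodule.liftQ_apply _ _ _

/-- A linear map whose values lie in the range of an injection factors through it. -/
lemma exists_factor_of_injective {X : Type*} [AddCommGroup X] [Module A X] {s : V →ₗ[A] W}
    (hs : Function.Injective s) (t : X →ₗ[A] W) (h : ∀ x, ∃ v, s v = t x) :
    ∃ g : X →ₗ[A] V, ∀ x, s (g x) = t x := by
  refine ⟨(LinearEquiv.ofInjective s hs).symm.toLinearMap ∘ₗ t.codRestrict _ h, fun x => ?_⟩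
  have := (LinearEquiv.ofInjective s hs).apply_symm_apply (t.codRestrict _ h x)
  exact congrArg Subtype.val this

lemma exists_projective_lift {P : Type u} [AddCommGroup P] [Module A P] [Module.Projective A P]
    {s : V →ₗ[A] W} (hs : Function.Surjective s) (t : P →ₗ[A] W) :
    ∃ g : P →ₗ[A] V, ∀ x, s (g x) = t x := by
  obtain ⟨g, hg⟩ := Module.projective_lifting_property s t hs
  exact ⟨g, fun x => LinearMap.congr_fun hg x⟩

/-- The vanishing of `Ext¹` can be tested on one projective presentation. -/
lemma extVanishesOnProjectives_of_presentation {K P M : Type u} [AddCommGroup K] [AddCommGroup P]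
    [AddCommGroup M] [Module A K] [Module A P] [Module A M] [Module.Projective A P]
    {i : K →ₗ[A] P} {p : P →ₗ[A] M} (hip : IsShortExact i p)
    (H : ∀ (Q : Type u) [AddCommGroup Q] [Module A Q] (q : K →ₗ[A] Q), Module.Projective A Q →
      ∃ h : P →ₗ[A] Q, ∀ k, h (i k) = q k) : ExtVanishesOnProjectives A M := by
  intro U V Q _ _ _ _ _ _ f g q hfg hQ
  obtain ⟨l, hl⟩ := exists_projective_lift hfg.surjective p
  obtain ⟨m, hm⟩ := exists_factor_of_injective hfg.injective (l ∘ₗ i) fun k =>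
    (hfg.exact _).1 (by simp [hl, hip.comp_apply])
  obtain ⟨h, hh⟩ := H Q (q ∘ₗ m) hQ
  have hs : Function.Surjective (l.coprod f) := fun v => by
    obtain ⟨x, hx⟩ := hip.surjective (g v)
    obtain ⟨y, hy⟩ := (hfg.exact (v - l x)).1 (by simp [hl, hx])
    exact ⟨(x, y), by simp [hy]⟩
  -- V is the pushout of P and U under K: the kernel of (l, f) consists of the pairs (i k, -m k), on
  -- which (h, q) vanishes.
  obtain ⟨e, he⟩ := exists_factor_of_surjective hs (h.coprod q) fun ⟨x, y⟩ hxy => by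
    simp only [LinearMap.coprod_apply] at hxy ⊢
    obtain ⟨k, rfl⟩ := (hip.exact x).1 (by
      have := congrArg g hxy
      simpa [hl, hfg.comp_apply] using this)
    have h1 := hm k
    simp only [LinearMap.comp_apply] at h1
    rw [← h1, ← map_add] at hxy
    have h2 := hfg.injective (hxy.trans (map_zero f).symm)
    rw [hh, LinearMap.comp_apply, ← map_add, h2, map_zero]
  refine ⟨e, fun u => ?_⟩
  have := he (0, u)
  simpa using this

/-- Extend in two stages, U ⊆ ker (p ∘ g) ⊆ V, with successive quotients M' and M''. -/
lemma ExtVanishesOnProjectives.of_extension {M' M M'' : Type u} [AddCommGroup M'] [AddCommGroup M]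
    [AddCommGroup M''] [Module A M'] [Module A M] [Module A M''] {i : M' →ₗ[A] M}
    {p : M →ₗ[A] M''} (hip : IsShortExact i p) (h' : ExtVanishesOnProjectives A M')
    (h'' : ExtVanishesOnProjectives A M'') : ExtVanishesOnProjectives A M := by
  intro U V Q _ _ _ _ _ _ f g q hfg hQ
  have hpg : Function.Surjective (p ∘ₗ g) := hip.surjective.comp hfg.surjective
  obtain ⟨f', hf'⟩ := exists_factor_of_injective (s := (LinearMap.ker (p ∘ₗ g)).subtype)
    Subtype.val_injective f fun u => ⟨⟨f u, by simp [hfg.comp_apply]⟩, rfl⟩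
  obtain ⟨g', hg'⟩ := exists_factor_of_injective hip.injective
    (g ∘ₗ (LinearMap.ker (p ∘ₗ g)).subtype) fun x => (hip.exact _).1 x.2
  have hs : IsShortExact f' g' := by
    refine ⟨fun a b hab => hfg.injective ?_, fun v => ⟨fun hv => ?_, ?_⟩, fun m => ?_⟩
    · rw [← hf', ← hf', hab]
    · obtain ⟨u, hu⟩ := (hfg.exact v.1).1 (by
        have := hg' v
        rw [hv, map_zero] at this
        exact this.symm)
      exact ⟨u, Subtype.ext ((hf' u).trans hu)⟩
    · rintro ⟨u, rfl⟩
      apply hip.injective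
      have h1 := hf' u
      have h2 := hg' (f' u)
      simp only [LinearMap.comp_apply] at h2
      rw [h2, h1, hfg.comp_apply, map_zero]
    · obtain ⟨v, hv⟩ := hfg.surjective (i m)
      refine ⟨⟨v, by simp [hv, hip.comp_apply]⟩, hip.injective ?_⟩
      rw [hg']
      exact hv
  obtain ⟨h, hh⟩ := h' _ _ Q f' g' q hs hQ
  obtain ⟨k, hk⟩ := h'' _ _ Q _ _ h (isShortExact_subtype hpg) hQ
  refine ⟨k, fun u => ?_⟩
  rw [← hh, ← hk, hf']

/-- Pull the sequence back along r, extend over the fibre product S, and restrict along V → S, v ↦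
(v, i (g v)). -/
lemma ExtVanishesOnProjectives.of_retract {X E : Type u} [AddCommGroup X] [AddCommGroup E]
    [Module A X] [Module A E] (i : X →ₗ[A] E) (r : E →ₗ[A] X) (hri : ∀ x, r (i x) = x)
    (hE : ExtVanishesOnProjectives A E) : ExtVanishesOnProjectives A X := by
  intro U V Q _ _ _ _ _ _ f g q hfg hQ
  let S := LinearMap.ker (g.coprod (-r))
  have hS : ∀ x : V × E, x ∈ S ↔ g x.1 = r x.2 := fun x => by
    simp [S, ← sub_eq_add_neg, sub_eq_zero]
  let j : U →ₗ[A] S := (f.prod 0).codRestrict S fun u => by simp [hS, hfg.comp_apply]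
  have hs : IsShortExact j (LinearMap.snd A V E ∘ₗ S.subtype) := by
    refine ⟨fun a b hab => hfg.injective (congrArg (fun s : S => s.1.1) hab),
      fun ⟨⟨v, e⟩, hv⟩ => ⟨fun he => ?_, ?_⟩, fun e => ?_⟩
    · change e = 0 at he
      subst he
      obtain ⟨u, rfl⟩ := (hfg.exact v).1 (by simpa using (hS _).1 hv)
      exact ⟨u, rfl⟩
    · rintro ⟨u, hu⟩
      exact (congrArg (fun s : S => s.1.2) hu).symm
    · obtain ⟨v, hv⟩ := hfg.surjective (r e)
      exact ⟨⟨(v, e), (hS _).2 hv⟩, rfl⟩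
  obtain ⟨h, hh⟩ := hE _ _ Q j _ q hs hQ
  refine ⟨h ∘ₗ (LinearMap.id.prod (i ∘ₗ g)).codRestrict S fun v => by simp [hS, hri], fun u => ?_⟩
  rw [← hh]
  refine congrArg h (Subtype.ext ?_)
  simp [j, hfg.comp_apply]

lemma extVanishesOnProjectives_of_projective (P : Type u) [AddCommGroup P] [Module A P]
    [Module.Projective A P] : ExtVanishesOnProjectives A P :=
  extVanishesOnProjectives_of_presentation (K := PUnit) (i := 0) (p := LinearMap.id)
    ⟨Function.injective_of_subsingleton _, fun v => by simp [eq_comm], Function.surjective_id⟩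
    fun _ _ _ q _ => ⟨0, fun k =>
      ((congrArg q (Subsingleton.elim k 0)).trans (map_zero q)).symm⟩

end ShortExact

/-! ### Gorenstein classes and their closure properties -/

section GorensteinClass

variable {A : Type u} [Ring A]

/-- `X` embeds into a projective module with cokernel in the class `C`. -/
def HasProjectiveEmbedding (C : ModuleCat.{u} A → Prop) (X : Type u) [AddCommGroup X]
    [Module A X] : Prop :=
  ∃ (P N : ModuleCat.{u} A) (f : X →ₗ[A] P) (g : P →ₗ[A] N),
    IsShortExact f g ∧ Module.Projective A P ∧ C N

/-- `X` is a quotient of a projective module with kernel in the class `C`. -/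
def HasProjectiveCover (C : ModuleCat.{u} A → Prop) (X : Type u) [AddCommGroup X]
    [Module A X] : Prop :=
  ∃ (K P : ModuleCat.{u} A) (f : K →ₗ[A] P) (g : P →ₗ[A] X),
    IsShortExact f g ∧ Module.Projective A P ∧ C K

/-- A class of modules that is closed under taking suitable syzygies and cosyzygies. -/
def IsGorensteinClass (C : ModuleCat.{u} A → Prop) : Prop :=
  ∀ X : ModuleCat.{u} A, C X →
    ExtVanishesOnProjectives A X ∧ HasProjectiveEmbedding C X ∧ HasProjectiveCover C X

/-- `M` belongs to some Gorenstein class. -/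
def InGorensteinClass (A : Type u) [Ring A] (M : Type u) [AddCommGroup M] [Module A M] : Prop :=
  ∃ C : ModuleCat.{u} A → Prop, IsGorensteinClass C ∧ C (ModuleCat.of A M)

variable {M M' M'' : Type u} [AddCommGroup M] [AddCommGroup M'] [AddCommGroup M'']
  [Module A M] [Module A M'] [Module A M'']

lemma InGorensteinClass.extVanishes (h : InGorensteinClass A M) : ExtVanishesOnProjectives A M := by
  obtain ⟨C, hC, hM⟩ := h
  exact (hC _ hM).1

lemma InGorensteinClass.embedding (h : InGorensteinClass A M) :
    HasProjectiveEmbedding (fun X : ModuleCat.{u} A => InGorensteinClass A X) M := by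
  obtain ⟨C, hC, hM⟩ := h
  obtain ⟨P, N, f, g, h1, h2, h3⟩ := (hC _ hM).2.1
  exact ⟨P, N, f, g, h1, h2, C, hC, h3⟩

lemma InGorensteinClass.cover (h : InGorensteinClass A M) :
    HasProjectiveCover (fun X : ModuleCat.{u} A => InGorensteinClass A X) M := by
  obtain ⟨C, hC, hM⟩ := h
  obtain ⟨P, N, f, g, h1, h2, h3⟩ := (hC _ hM).2.2
  exact ⟨P, N, f, g, h1, h2, C, hC, h3⟩

lemma InGorensteinClass.of_projective [Module.Projective A M] : InGorensteinClass A M := by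
  refine ⟨fun X => Module.Projective A X, fun X hX => ⟨extVanishesOnProjectives_of_projective _,
    ⟨X, ModuleCat.of A PUnit, LinearMap.id, 0, ⟨Function.injective_id, fun v => by simp,
      Function.surjective_to_subsingleton _⟩, hX, ?_⟩,
    ⟨ModuleCat.of A PUnit, X, 0, LinearMap.id, ⟨Function.injective_of_subsingleton _,
      fun v => by simp [eq_comm], Function.surjective_id⟩, hX, ?_⟩⟩, ‹_›⟩ <;>
  exact Module.Projective.of_free (R := A) (P := PUnit.{u + 1})

/-- Membership in Gorenstein classes is closed under extensions. -/
lemma InGorensteinClass.of_extension {i : M' →ₗ[A] M} {p : M →ₗ[A] M''} (hip : IsShortExact i p)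
    (h' : InGorensteinClass A M') (h'' : InGorensteinClass A M'') : InGorensteinClass A M := by
  -- The class of all extensions of members is itself a Gorenstein class, by the horseshoe
  -- construction on both sides.
  refine ⟨fun E => ∃ (M' M'' : ModuleCat.{u} A) (i : M' →ₗ[A] E) (p : E →ₗ[A] M''),
    IsShortExact i p ∧ InGorensteinClass A M' ∧ InGorensteinClass A M'', ?_,
    ModuleCat.of A M', ModuleCat.of A M'', i, p, hip, h', h''⟩
  clear hip h' h''
  rintro E ⟨M', M'', i, p, hip, h', h''⟩
  refine ⟨.of_extension hip h'.extVanishes h''.extVanishes, ?_, ?_⟩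
  · obtain ⟨P', L', f', g', hs', hP', hL'⟩ := h'.embedding
    obtain ⟨P'', L'', f'', g'', hs'', hP'', hL''⟩ := h''.embedding
    -- Ext¹(M'', P') = 0 extends f' to all of E; the cokernel of E → P' × P'' is then an extension
    -- of L'' by L'.
    obtain ⟨a, ha⟩ := h''.extVanishes _ _ _ i p f' hip hP'
    have hf : Function.Injective (a.prod (f'' ∘ₗ p)) := by
      rw [← LinearMap.ker_eq_bot, LinearMap.ker_eq_bot']
      intro e he
      simp only [linearMap_prod_apply, LinearMap.comp_apply, Prod.mk_eq_zero] at he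
      obtain ⟨m, rfl⟩ := (hip.exact e).1 (hs''.injective (he.2.trans (map_zero f'').symm))
      rw [hs'.injective ((ha m).symm.trans (he.1.trans (map_zero f').symm)), map_zero]
    have hs := isShortExact_mkQ hf
    set π := (LinearMap.range (a.prod (f'' ∘ₗ p))).mkQ
    obtain ⟨s, hs1⟩ := exists_factor_of_surjective hs'.surjective (π ∘ₗ LinearMap.inl A P' P'')
      fun v hv => by
        obtain ⟨m, rfl⟩ := (hs'.exact v).1 hv
        exact (hs.exact _).2 ⟨i m, by simp [ha, hip.comp_apply]⟩
    obtain ⟨t, ht⟩ := exists_factor_of_surjective hs.surjective (g'' ∘ₗ LinearMap.snd A P' P'')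
      fun v hv => by
        obtain ⟨e, rfl⟩ := (hs.exact v).1 hv
        simp [hs''.comp_apply]
    simp only [LinearMap.comp_apply, LinearMap.inl_apply, LinearMap.snd_apply] at hs1 ht
    refine ⟨ModuleCat.of A (P' × P''), ModuleCat.of A _, _, _, hs,
      inferInstanceAs (Module.Projective A (P' × P'')), L', L'', s, t, ⟨?_, ?_, ?_⟩, hL', hL''⟩
    · rw [← LinearMap.ker_eq_bot, LinearMap.ker_eq_bot']
      intro x hx
      obtain ⟨y, rfl⟩ := hs'.surjective x
      rw [hs1] at hx
      obtain ⟨e, he⟩ := (hs.exact _).1 hx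
      simp only [linearMap_prod_apply, LinearMap.comp_apply, Prod.mk.injEq] at he
      obtain ⟨m, rfl⟩ := (hip.exact e).1 (hs''.injective (he.2.trans (map_zero f'').symm))
      exact (hs'.exact _).2 ⟨m, by rw [← ha, he.1]⟩
    · intro x
      obtain ⟨⟨y', y''⟩, rfl⟩ := hs.surjective x
      refine ⟨fun hx => ?_, ?_⟩
      · rw [ht] at hx
        obtain ⟨m, hm⟩ := (hs''.exact _).1 hx
        obtain ⟨e, rfl⟩ := hip.surjective m
        refine ⟨g' (y' - a e), ?_⟩
        rw [hs1, ← sub_eq_zero, ← map_sub]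
        refine (hs.exact _).2 ⟨-e, ?_⟩
        simp [hm]
      · rintro ⟨w, hw⟩
        obtain ⟨v, rfl⟩ := hs'.surjective w
        rw [← hw, hs1, ht, map_zero]
    · intro y
      obtain ⟨x, rfl⟩ := hs''.surjective y
      exact ⟨π (0, x), by rw [ht]⟩
  · obtain ⟨K', P', f', g', hs', hP', hK'⟩ := h'.cover
    obtain ⟨K'', P'', f'', g'', hs'', hP'', hK''⟩ := h''.cover
    obtain ⟨b, hb⟩ := exists_projective_lift hip.surjective g''
    have hg : Function.Surjective ((i ∘ₗ g').coprod b) := fun e => by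
      obtain ⟨y, hy⟩ := hs''.surjective (p e)
      obtain ⟨m, hm⟩ := (hip.exact (e - b y)).1 (by simp [hb, hy])
      obtain ⟨x, rfl⟩ := hs'.surjective m
      exact ⟨(x, y), by simp [hm]⟩
    have hs := isShortExact_subtype hg
    obtain ⟨s, hs1⟩ := exists_factor_of_injective hs.injective (LinearMap.inl A P' P'' ∘ₗ f')
      fun k => (hs.exact _).1 (by simp [hs'.comp_apply])
    obtain ⟨t, ht⟩ := exists_factor_of_injective hs''.injective
      (LinearMap.snd A P' P'' ∘ₗ (LinearMap.ker ((i ∘ₗ g').coprod b)).subtype) fun x =>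
        (hs''.exact _).1 (by
          have h0 : i (g' x.1.1) + b x.1.2 = 0 := hs.comp_apply x
          have h1 := congrArg p h0
          simpa [hip.comp_apply, hb] using h1)
    simp only [LinearMap.comp_apply, LinearMap.inl_apply, LinearMap.snd_apply,
      Submodule.subtype_apply] at hs1 ht
    refine ⟨ModuleCat.of A _, ModuleCat.of A (P' × P''), _, _, hs,
      inferInstanceAs (Module.Projective A (P' × P'')), K', K'', s, t, ⟨?_, ?_, ?_⟩, hK', hK''⟩
    · intro x y hxy
      have h1 := (hs1 x).symm.trans ((congrArg Subtype.val hxy).trans (hs1 y))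
      exact hs'.injective (congrArg Prod.fst h1)
    · intro x
      refine ⟨fun hx => ?_, ?_⟩
      · have h2 : x.1.2 = 0 := by rw [← ht, hx, map_zero]
        have h1 : i (g' x.1.1) = 0 := by
          have h3 : i (g' x.1.1) + b x.1.2 = 0 := hs.comp_apply x
          simpa [h2] using h3
        obtain ⟨k, hk⟩ := (hs'.exact x.1.1).1 (hip.injective (h1.trans (map_zero i).symm))
        exact ⟨k, Subtype.ext ((hs1 k).trans (Prod.ext hk h2.symm))⟩
      · rintro ⟨k, rfl⟩
        apply hs''.injective
        rw [ht, hs1, map_zero]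
    · intro k
      obtain ⟨m, hm⟩ := (hip.exact (b (f'' k))).1 (by rw [hb, hs''.comp_apply])
      obtain ⟨x, rfl⟩ := hs'.surjective m
      refine ⟨⟨(-x, f'' k), by simp [hm]⟩, hs''.injective ?_⟩
      rw [ht]

/-- The retracts of members form a Gorenstein class: the new cokernel N need not be visibly a
member, but it is a summand of N × X, which is an extension of L by E. Dually, K' × X is an
extension of E by K. -/
lemma InGorensteinClass.of_retract (i : M →ₗ[A] M') (r : M' →ₗ[A] M) (hri : ∀ x, r (i x) = x)
    (h : InGorensteinClass A M') : InGorensteinClass A M := by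
  refine ⟨fun X => ∃ (E : ModuleCat.{u} A) (i : X →ₗ[A] E) (r : E →ₗ[A] X),
    (∀ x, r (i x) = x) ∧ InGorensteinClass A E, ?_, ModuleCat.of A M', i, r, hri, h⟩
  clear h hri r i
  rintro X ⟨E, i, r, hri, hE⟩
  have hi : Function.Injective i := Function.LeftInverse.injective hri
  refine ⟨.of_retract i r hri hE.extVanishes, ?_, ?_⟩
  · obtain ⟨P, L, f, g, hs, hP, hL⟩ := hE.embedding
    have hX := isShortExact_mkQ (f := f ∘ₗ i) (hs.injective.comp hi)
    set N := P ⧸ LinearMap.range (f ∘ₗ i)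
    set π : P →ₗ[A] N := (LinearMap.range (f ∘ₗ i)).mkQ
    obtain ⟨t, ht⟩ := exists_factor_of_surjective hX.surjective g fun v hv => by
      obtain ⟨x, rfl⟩ := (hX.exact v).1 hv
      simp [hs.comp_apply]
    refine ⟨P, ModuleCat.of A N, _, _, hX, hP, ModuleCat.of A (N × X), LinearMap.inl A N X,
      LinearMap.fst A N X, fun x => rfl,
      .of_extension (i := (π ∘ₗ f).prod r) (p := t ∘ₗ LinearMap.fst A N X) ⟨?_, ?_, ?_⟩ hE hL⟩
    · rw [← LinearMap.ker_eq_bot, LinearMap.ker_eq_bot']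
      intro e he
      simp only [linearMap_prod_apply, LinearMap.comp_apply, Prod.mk_eq_zero] at he
      obtain ⟨x, hx⟩ := (hX.exact _).1 he.1
      have := hs.injective hx
      rw [← this, hri] at he
      rw [← this, he.2, map_zero]
    · rintro ⟨n, x⟩
      obtain ⟨v, rfl⟩ := hX.surjective n
      refine ⟨fun h => ?_, ?_⟩
      · obtain ⟨e, rfl⟩ := (hs.exact v).1 ((ht v).symm.trans h)
        -- The correction lies in i(X), so π ∘ f does not see it, while it moves the second
        -- coordinate from r e to x.
        refine ⟨e + i (x - r e), ?_⟩
        have : π (f (i (x - r e))) = 0 := (hX.exact _).2 ⟨_, rfl⟩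
        simp only [linearMap_prod_apply, LinearMap.comp_apply, map_add, this, hri]
        simp
      · rintro ⟨e, he⟩
        have h1 := congrArg Prod.fst he
        simp only [linearMap_prod_apply, LinearMap.comp_apply] at h1
        simp only [LinearMap.comp_apply, LinearMap.fst_apply]
        rw [← h1, ht, hs.comp_apply]
    · intro l
      obtain ⟨v, rfl⟩ := hs.surjective l
      exact ⟨(π v, 0), ht v⟩
  · obtain ⟨K, P, f, g, hs, hP, hK⟩ := hE.cover
    have hr : Function.Surjective r := Function.LeftInverse.surjective hri
    have hX := isShortExact_subtype (g := r ∘ₗ g) (hr.comp hs.surjective)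
    set K' := LinearMap.ker (r ∘ₗ g)
    obtain ⟨s, hs1⟩ := exists_factor_of_injective hX.injective f fun k =>
      (hX.exact _).1 (by simp [hs.comp_apply])
    simp only [Submodule.subtype_apply] at hs1
    refine ⟨ModuleCat.of A K', P, _, _, hX, hP, ModuleCat.of A (K' × X), LinearMap.inl A K' X,
      LinearMap.fst A K' X, fun x => rfl,
      .of_extension (i := LinearMap.inl A K' X ∘ₗ s) (p := (g ∘ₗ K'.subtype).coprod i)
        ⟨?_, ?_, ?_⟩ hK hE⟩
    · intro a b hab
      have h1 := congrArg (fun z : K' × X => z.1.1) hab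
      simp only [LinearMap.comp_apply, LinearMap.inl_apply, hs1] at h1
      exact hs.injective h1
    · rintro ⟨k, x⟩
      simp only [LinearMap.coprod_apply, LinearMap.comp_apply, LinearMap.inl_apply,
        Submodule.subtype_apply, Prod.mk.injEq]
      refine ⟨fun h => ?_, ?_⟩
      · have hx : x = 0 := by
          have h1 := congrArg r h
          have h2 : r (g k) = 0 := k.2
          simpa [hri, h2] using h1
        subst hx
        rw [map_zero, add_zero] at h
        obtain ⟨y, hy⟩ := (hs.exact _).1 h
        exact ⟨y, Subtype.ext ((hs1 y).trans hy), rfl⟩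
      · rintro ⟨y, rfl, rfl⟩
        rw [hs1, hs.comp_apply, map_zero, add_zero]
    · intro e
      obtain ⟨y, hy⟩ := hs.surjective (e - i (r e))
      exact ⟨(⟨y, by simp [K', hy, hri]⟩, r e), by simp [hy]⟩

/-- Kernels of projective presentations stay in Gorenstein classes. -/
lemma InGorensteinClass.of_projective_presentation {K P : Type u} [AddCommGroup K] [AddCommGroup P]
    [Module A K] [Module A P] [Module.Projective A P] {f : K →ₗ[A] P} {g : P →ₗ[A] M}
    (hs : IsShortExact f g) (h : InGorensteinClass A M) : InGorensteinClass A K := by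
  obtain ⟨K', P', f', g', hs', hP', hK'⟩ := h.cover
  -- Schanuel: the fibre product of P and P' over M is an extension of P by K', and K is a retract
  -- of it since g' lifts to P.
  let S := LinearMap.ker (g.coprod (-g'))
  have hS : ∀ x : P × P', x ∈ S ↔ g x.1 = g' x.2 := fun x => by
    simp [S, ← sub_eq_add_neg, sub_eq_zero]
  have hE : InGorensteinClass A S := by
    refine .of_extension (i := (LinearMap.prod 0 f').codRestrict S fun k => by
      simp [hS, hs'.comp_apply]) (p := LinearMap.fst A P P' ∘ₗ S.subtype) ⟨?_, ?_, ?_⟩ hK'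
      .of_projective
    · intro a b hab
      exact hs'.injective (congrArg (fun z : S => z.1.2) hab)
    · rintro ⟨⟨x, y⟩, hxy⟩
      refine ⟨fun hx => ?_, ?_⟩
      · change x = 0 at hx
        subst hx
        obtain ⟨k, rfl⟩ := (hs'.exact y).1 (by simpa [eq_comm] using (hS _).1 hxy)
        exact ⟨k, rfl⟩
      · rintro ⟨k, hk⟩
        exact (congrArg (fun z : S => z.1.1) hk).symm
    · intro x
      obtain ⟨y, hy⟩ := hs'.surjective (g x)
      exact ⟨⟨(x, y), (hS _).2 hy.symm⟩, rfl⟩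
  obtain ⟨t, ht⟩ := exists_projective_lift hs.surjective g'
  obtain ⟨r, hr⟩ := exists_factor_of_injective hs.injective
    ((LinearMap.id.coprod (-t)) ∘ₗ S.subtype) fun x => (hs.exact _).1 (by
      have := (hS _).1 x.2
      simp [ht, this])
  refine .of_retract ((f.prod 0).codRestrict S fun k => by simp [hS, hs.comp_apply]) r
    (fun k => hs.injective ?_) hE
  rw [hr]
  simp

/-- Cokernels of embeddings into projective modules stay in Gorenstein classes if `Ext¹` of them
vanishes on projectives. -/
lemma InGorensteinClass.of_projective_embedding {P N : Type u} [AddCommGroup P] [AddCommGroup N]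
    [Module A P] [Module A N] [Module.Projective A P] {f : M →ₗ[A] P} {g : P →ₗ[A] N}
    (hs : IsShortExact f g) (hN : ExtVanishesOnProjectives A N) (h : InGorensteinClass A M) :
    InGorensteinClass A N := by
  obtain ⟨P', L, f', g', hs', hP', hL⟩ := h.embedding
  -- Dual Schanuel: Ext¹(N, P') = 0 supplies t, which makes N a retract of the pushout E of P and P'
  -- under M; E is an extension of L by P.
  obtain ⟨t, ht⟩ := hN _ _ _ f g f' hs hP'
  let j := f.prod (-f')
  have hj := isShortExact_mkQ (f := j) fun a b hab => hs.injective (congrArg Prod.fst hab)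
  set E := (P × P') ⧸ LinearMap.range j
  set π : P × P' →ₗ[A] E := (LinearMap.range j).mkQ
  obtain ⟨b, hb⟩ := exists_factor_of_surjective hj.surjective (g' ∘ₗ LinearMap.snd A P P')
    fun v hv => by
      obtain ⟨m, rfl⟩ := (hj.exact v).1 hv
      simp [j, hs'.comp_apply]
  obtain ⟨r, hr⟩ := exists_factor_of_surjective hj.surjective (g ∘ₗ LinearMap.fst A P P')
    fun v hv => by
      obtain ⟨m, rfl⟩ := (hj.exact v).1 hv
      simp [j, hs.comp_apply]
  obtain ⟨i, hi⟩ := exists_factor_of_surjective hs.surjective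
    (π ∘ₗ LinearMap.id.prod (-t)) fun v hv => by
      obtain ⟨m, rfl⟩ := (hs.exact v).1 hv
      exact (hj.exact _).2 ⟨m, by simp [j, ht]⟩
  have hE : InGorensteinClass A E := by
    refine .of_extension (i := π ∘ₗ LinearMap.inl A P P') (p := b) ⟨?_, ?_, ?_⟩ .of_projective hL
    · rw [← LinearMap.ker_eq_bot, LinearMap.ker_eq_bot']
      intro x hx
      obtain ⟨m, hm⟩ := (hj.exact _).1 hx
      simp only [j, linearMap_prod_apply, LinearMap.inl_apply, Prod.mk.injEq,
        LinearMap.neg_apply, neg_eq_zero] at hm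
      rw [← hm.1, hs'.injective (hm.2.trans (map_zero f').symm), map_zero]
    · intro e
      obtain ⟨⟨x, y⟩, rfl⟩ := hj.surjective e
      refine ⟨fun h0 => ?_, ?_⟩
      · obtain ⟨m, rfl⟩ := (hs'.exact y).1 ((hb _).symm.trans h0)
        refine ⟨x + f m, ?_⟩
        rw [LinearMap.comp_apply, ← sub_eq_zero, ← map_sub]
        exact (hj.exact _).2 ⟨m, by simp [j]⟩
      · rintro ⟨w, hw⟩
        rw [← hw, LinearMap.comp_apply, hb]
        simp
    · intro l
      obtain ⟨y, rfl⟩ := hs'.surjective l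
      exact ⟨π (0, y), hb _⟩
  refine .of_retract i r (fun n => ?_) hE
  obtain ⟨x, rfl⟩ := hs.surjective n
  rw [hi, LinearMap.comp_apply, hr]
  simp

end GorensteinClass

/-! ### Totally acyclic complexes and Gorenstein classes -/

section TotallyAcyclic

variable {A : Type u} [Ring A]

lemma chainComplex_exactAt_iff (P : ChainComplex (ModuleCat.{u} A) ℤ) (k : ℤ) :
    P.ExactAt (k + 1) ↔ ∀ x : P.X (k + 1), (P.d (k + 1) k).hom x = 0 →
      ∃ y, (P.d (k + 1 + 1) (k + 1)).hom y = x := by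
  rw [P.exactAt_iff' (k + 1 + 1) (k + 1) k (by simp) (by simp),
    ShortComplex.moduleCat_exact_iff]
  rfl

lemma chainComplex_hom_exactAt_iff (P : ChainComplex (ModuleCat.{u} A) ℤ) (Q : ModuleCat.{u} A)
    (k : ℤ) :
    (((preadditiveYoneda.obj Q).mapHomologicalComplex _).obj P.op).ExactAt (k + 1) ↔
      ∀ t : P.X (k + 1) →ₗ[A] Q, (∀ x, t ((P.d (k + 1 + 1) (k + 1)).hom x) = 0) →
        ∃ h : P.X k →ₗ[A] Q, ∀ x, h ((P.d (k + 1) k).hom x) = t x := by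
  rw [HomologicalComplex.exactAt_iff' _ k (k + 1) (k + 1 + 1)
    (ComplexShape.prev_eq' _ (by simp)) (ComplexShape.next_eq' _ (by simp)),
    ShortComplex.ab_exact_iff]
  constructor
  · intro H t ht
    obtain ⟨h, hh⟩ := H (ModuleCat.ofHom t) (ModuleCat.hom_ext (LinearMap.ext ht))
    exact ⟨h.hom, fun x => LinearMap.congr_fun (congrArg ModuleCat.Hom.hom hh) x⟩
  · intro H t ht
    obtain ⟨h, hh⟩ := H t.hom fun x => LinearMap.congr_fun (congrArg ModuleCat.Hom.hom ht) x
    exact ⟨ModuleCat.ofHom h, ModuleCat.hom_ext (LinearMap.ext hh)⟩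

/-- Acyclicity makes consecutive images syzygies of each other, and acyclicity of Hom(P, Q) is the
required Ext¹-vanishing. -/
lemma IsTotallyAcyclic.isGorensteinClass {P : ChainComplex (ModuleCat.{u} A) ℤ}
    (hP : IsTotallyAcyclic P) : IsGorensteinClass fun X : ModuleCat.{u} A =>
      ∃ i : ℤ, Nonempty (X ≃ₗ[A] LinearMap.range (P.d (i + 1) i).hom) := by
  have hd : ∀ i (y : P.X (i + 1 + 1)), (P.d (i + 1) i).hom ((P.d (i + 1 + 1) (i + 1)).hom y) = 0 :=
    fun i y => LinearMap.congr_fun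
      (congrArg ModuleCat.Hom.hom (P.d_comp_d (i + 1 + 1) (i + 1) i)) y
  have hex : ∀ i x, (P.d (i + 1) i).hom x = 0 ↔ ∃ y, (P.d (i + 1 + 1) (i + 1)).hom y = x :=
    fun i x => ⟨(chainComplex_exactAt_iff P i).1 (hP.acyclic _) x, by rintro ⟨y, rfl⟩; exact hd i y⟩
  rintro X ⟨i, ⟨e⟩⟩
  have hs : IsShortExact (LinearMap.range (P.d (i + 1 + 1) (i + 1)).hom).subtype
      (e.symm.toLinearMap ∘ₗ (P.d (i + 1) i).hom.rangeRestrict) := by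
    refine ⟨Subtype.val_injective, fun v => ?_, e.symm.surjective.comp
      (LinearMap.surjective_rangeRestrict _)⟩
    rw [LinearMap.comp_apply, LinearEquiv.coe_coe, LinearEquiv.map_eq_zero_iff, Subtype.ext_iff]
    change (P.d (i + 1) i).hom v = 0 ↔ _
    rw [hex]
    exact ⟨fun h => ⟨⟨v, h⟩, rfl⟩, by rintro ⟨u, rfl⟩; exact u.2⟩
  refine ⟨?_, ?_, ModuleCat.of A _, P.X (i + 1), _, _, hs, hP.projective _, i + 1,
    ⟨LinearEquiv.refl _ _⟩⟩
  · have := hP.projective (i + 1)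
    refine extVanishesOnProjectives_of_presentation hs fun Q _ _ q hQ => ?_
    obtain ⟨h, hh⟩ := (chainComplex_hom_exactAt_iff P (ModuleCat.of A Q) (i + 1)).1
      (hP.hom_acyclic _ hQ _) (q ∘ₗ (P.d (i + 1 + 1) (i + 1)).hom.rangeRestrict) fun x => by
        rw [LinearMap.comp_apply, ← map_zero q]
        exact congrArg q (Subtype.ext (hd _ x))
    refine ⟨h, ?_⟩
    rintro ⟨_, y, rfl⟩
    exact hh y
  · obtain ⟨j, rfl⟩ : ∃ j, i = j + 1 := ⟨i - 1, by ring⟩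
    refine ⟨P.X (j + 1), ModuleCat.of A (LinearMap.range (P.d (j + 1) j).hom),
      (LinearMap.range (P.d (j + 1 + 1) (j + 1)).hom).subtype ∘ₗ e.toLinearMap,
      (P.d (j + 1) j).hom.rangeRestrict, ⟨Subtype.val_injective.comp e.injective, fun v => ?_,
      LinearMap.surjective_rangeRestrict _⟩, hP.projective _, j, ⟨LinearEquiv.refl _ _⟩⟩
    rw [Subtype.ext_iff]
    change (P.d (j + 1) j).hom v = 0 ↔ _
    rw [hex]
    refine ⟨fun h => ⟨e.symm ⟨v, h⟩, by simp⟩, ?_⟩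
    rintro ⟨u, rfl⟩
    exact (e u).2

lemma exists_int_chain {α : Type*} (r : α → α → Prop) (hl : ∀ x, ∃ y, r x y)
    (hr : ∀ x, ∃ y, r y x) (x : α) : ∃ Z : ℤ → α, Z 0 = x ∧ ∀ n, r (Z n) (Z (n + 1)) := by
  choose s hs using hl
  choose t ht using hr
  refine ⟨fun n => match n with
    | .ofNat n => s^[n] x
    | .negSucc n => t^[n + 1] x, rfl, ?_⟩
  rintro (n | _ | n)
  · change r (s^[n] x) (s^[n + 1] x)
    rw [Function.iterate_succ_apply']
    exact hs _
  · exact ht x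
  · change r (t^[n + 2] x) (t^[n + 1] x)
    rw [Function.iterate_succ_apply' t (n + 1)]
    exact ht _

/-- Iterate covers and embeddings in both directions from M and splice the sequences 0 → Z (n + 1) →
P n → Z n → 0. -/
lemma InGorensteinClass.isGorensteinProjective {M : Type u} [AddCommGroup M] [Module A M]
    (h : InGorensteinClass A M) : IsGorensteinProjective A M := by
  obtain ⟨Z, hZ0, hZ⟩ := exists_int_chain
    (α := {X : ModuleCat.{u} A // InGorensteinClass A X})
    (fun X Y => ∃ (P : ModuleCat.{u} A) (f : Y.1 →ₗ[A] P) (g : P →ₗ[A] X.1),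
      IsShortExact f g ∧ Module.Projective A P)
    (fun X => by
      obtain ⟨K, P, f, g, h1, h2, h3⟩ := X.2.cover
      exact ⟨⟨K, h3⟩, P, f, g, h1, h2⟩)
    (fun X => by
      obtain ⟨P, N, f, g, h1, h2, h3⟩ := X.2.embedding
      exact ⟨⟨N, h3⟩, P, f, g, h1, h2⟩) ⟨ModuleCat.of A M, h⟩
  choose P f g hs hP using hZ
  let d : ∀ n, P (n + 1) ⟶ P n := fun n => ModuleCat.ofHom (f n ∘ₗ g (n + 1))
  have hd : ∀ n, d (n + 1) ≫ d n = 0 := fun n => by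
    ext x
    simp [d, (hs (n + 1)).comp_apply]
  have hof : ∀ n, (ChainComplex.of P d hd).d (n + 1) n = d n := ChainComplex.of_d P d
  have hker : ∀ n x, f n (g (n + 1) x) = 0 ↔ ∃ u, f (n + 1) u = x := fun n x => by
    rw [← (hs (n + 1)).exact, ← (hs n).injective.eq_iff, map_zero]
  refine ⟨ChainComplex.of P d hd, ⟨hP, fun i => ?_, fun Q hQ i => ?_⟩, ?_⟩
  · obtain ⟨j, rfl⟩ : ∃ j, i = j + 1 := ⟨i - 1, by ring⟩
    rw [chainComplex_exactAt_iff, hof, hof]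
    intro x hx
    obtain ⟨u, rfl⟩ := (hker j x).1 hx
    obtain ⟨y, rfl⟩ := (hs (j + 1 + 1)).surjective u
    exact ⟨y, rfl⟩
  · obtain ⟨j, rfl⟩ : ∃ j, i = j + 1 := ⟨i - 1, by ring⟩
    rw [chainComplex_hom_exactAt_iff, hof, hof]
    intro t ht
    -- A cocycle t descends to Z (j + 1), then extends to P j because Ext¹(Z j, Q) = 0.
    obtain ⟨q, hq⟩ := exists_factor_of_surjective (hs (j + 1)).surjective t fun v hv => by
      obtain ⟨u, rfl⟩ := ((hs (j + 1)).exact v).1 hv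
      obtain ⟨y, rfl⟩ := (hs (j + 1 + 1)).surjective u
      exact ht y
    obtain ⟨k, hk⟩ := (Z j).2.extVanishes _ _ _ _ _ q (hs j) hQ
    refine ⟨k, fun x => ?_⟩
    rw [← hq, ← hk]
    rfl
  · have hr : ∀ k, k = -1 + 1 → LinearMap.range ((ChainComplex.of P d hd).d k (-1)).hom =
        LinearMap.range (f (-1)) := by
      rintro k rfl
      rw [hof]
      exact LinearMap.range_comp_of_range_eq_top _ (LinearMap.range_eq_top.2 (hs _).surjective)
    obtain ⟨e⟩ : Nonempty (M ≃ₗ[A] (Z (-1 + 1)).1) := by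
      rw [neg_add_cancel, hZ0]
      exact ⟨LinearEquiv.refl A M⟩
    exact ⟨e ≪≫ₗ LinearEquiv.ofInjective (f (-1)) (hs (-1)).injective ≪≫ₗ
      LinearEquiv.ofEq _ _ (hr 0 (by simp)).symm⟩

lemma isGorensteinProjective_iff (A : Type u) [Ring A] (M : Type u) [AddCommGroup M] [Module A M] :
    IsGorensteinProjective A M ↔ InGorensteinClass A M := by
  refine ⟨?_, InGorensteinClass.isGorensteinProjective⟩
  rintro ⟨P, hP, ⟨e⟩⟩
  exact ⟨_, hP.isGorensteinClass, -1, ⟨e⟩⟩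

end TotallyAcyclic

/-! ### Frobenius systems and coinduction -/

section Frobenius

open TensorProduct

/-- A Frobenius system for an algebra: a linear form `trace` with a pair of dual bases
`left`, `right`. -/
structure FrobeniusSystem (R A : Type u) [CommRing R] [Ring A] [Algebra R A] where
  rank : ℕ
  trace : A →ₗ[R] R
  left : Fin rank → A
  right : Fin rank → A
  sum_trace_mul_left : ∀ y, ∑ i, trace (y * left i) • right i = y
  sum_trace_right_mul : ∀ y, ∑ i, trace (right i * y) • left i = y

namespace FrobeniusSystem

variable {R A : Type u} [CommRing R] [Ring A] [Algebra R A]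

lemma projective (S : FrobeniusSystem R A) : Module.Projective R A :=
  .of_split (M := Fin S.rank → R)
    (LinearMap.pi fun i => S.trace ∘ₗ LinearMap.mulRight R (S.left i))
    (Fintype.linearCombination R S.right) <| LinearMap.ext fun y => by
      simpa [Fintype.linearCombination_apply] using S.sum_trace_mul_left y

lemma projective_restrictScalars (S : FrobeniusSystem R A) (P : Type u)
    [AddCommGroup P] [Module A P] [Module R P]
    [IsScalarTower R A P] [Module.Projective A P] : Module.Projective R P := by
  classical
  have := S.projective
  have : Module.Projective R (P →₀ A) := .of_equiv (finsuppLequivDFinsupp (ι := P) (M := A) R).symm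
  obtain ⟨s, hs⟩ := Module.projective_def'.1 ‹Module.Projective A P›
  exact .of_split (M := P →₀ A) (s.restrictScalars R)
    ((Finsupp.linearCombination A id).restrictScalars R)
    (LinearMap.ext fun x => LinearMap.congr_fun hs x)

variable {F : Type u} [AddCommGroup F] [Module R F]

/-- The map `A ⊗ F → F` which exhibits `A ⊗ F` as the coinduced module of `F`. -/
def counit (S : FrobeniusSystem R A) (F : Type u) [AddCommGroup F] [Module R F] :
    A ⊗[R] F →ₗ[R] F :=
  (TensorProduct.lid R F).toLinearMap ∘ₗ S.trace.rTensor F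

@[simp]
lemma counit_tmul (S : FrobeniusSystem R A) (x : A) (y : F) :
    S.counit F (x ⊗ₜ y) = S.trace x • y := by
  simp [counit]

lemma sum_tmul_counit (S : FrobeniusSystem R A) (t : A ⊗[R] F) :
    ∑ i, S.left i ⊗ₜ[R] S.counit F (S.right i • t) = t := by
  induction t with
  | zero => simp
  | add x y hx hy => simp [TensorProduct.tmul_add, Finset.sum_add_distrib, hx, hy]
  | tmul x y =>
    simp only [TensorProduct.smul_tmul', smul_eq_mul, counit_tmul]
    conv_rhs => rw [← S.sum_trace_right_mul x, TensorProduct.sum_tmul]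
    simp only [TensorProduct.tmul_smul, TensorProduct.smul_tmul']

lemma eq_of_counit_smul (S : FrobeniusSystem R A) {s t : A ⊗[R] F}
    (h : ∀ x : A, S.counit F (x • s) = S.counit F (x • t)) : s = t := by
  rw [← S.sum_tmul_counit s, ← S.sum_tmul_counit t]
  simp only [h]

variable {X : Type u} [AddCommGroup X] [Module A X] [Module R X] [IsScalarTower R A X]

/-- The lift is x ↦ ∑ leftᵢ ⊗ h (rightᵢ x). It is A-linear because the values `S.counit F (c • t)`
determine t. -/
lemma exists_coinduced_lift (S : FrobeniusSystem R A) (h : X →ₗ[R] F) :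
    ∃ k : X →ₗ[A] A ⊗[R] F, ∀ x, S.counit F (k x) = h x := by
  have key : ∀ (c : A) (x : X),
      S.counit F (c • ∑ i, S.left i ⊗ₜ[R] h (S.right i • x)) = h (c • x) := fun c x => by
    conv_rhs => rw [← S.sum_trace_mul_left c, Finset.sum_smul, map_sum]
    simp [Finset.smul_sum, TensorProduct.smul_tmul', smul_assoc]
  refine ⟨⟨⟨fun x => ∑ i, S.left i ⊗ₜ[R] h (S.right i • x), fun x y => ?_⟩, fun c x => ?_⟩,
    fun x => by simpa using key 1 x⟩
  · simp [TensorProduct.tmul_add, Finset.sum_add_distrib]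
  · refine S.eq_of_counit_smul fun d => ?_
    rw [key, RingHom.id_apply, ← mul_smul, ← mul_smul]
    exact (key (d * c) x).symm

/-! ### Transfer between A and R -/

variable {M : Type u} [AddCommGroup M] [Module A M] [Module R M] [IsScalarTower R A M]

lemma _root_.IsShortExact.restrictScalars {U V W : Type u} [AddCommGroup U] [AddCommGroup V]
    [AddCommGroup W] [Module A U] [Module A V] [Module A W] [Module R U] [Module R V] [Module R W]
    [IsScalarTower R A U] [IsScalarTower R A V] [IsScalarTower R A W] {f : U →ₗ[A] V}
    {g : V →ₗ[A] W} (h : IsShortExact f g) :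
    IsShortExact (f.restrictScalars R) (g.restrictScalars R) :=
  ⟨h.injective, h.exact, h.surjective⟩

/-- Maps to projective `R`-modules extend along embeddings whose cokernel has vanishing `Ext¹`
over `A`. -/
lemma exists_extension_of_extVanishes (S : FrobeniusSystem R A) {U V W : Type u}
    [AddCommGroup U] [AddCommGroup V] [AddCommGroup W] [Module A W]
    [Module A U] [Module A V] [Module R U] [Module R V] [IsScalarTower R A U] [IsScalarTower R A V]
    {f : U →ₗ[A] V} {g : V →ₗ[A] W} (hs : IsShortExact f g) (hW : ExtVanishesOnProjectives A W)
    [Module.Projective R F] (q : U →ₗ[R] F) : ∃ h : V →ₗ[R] F, ∀ u, h (f u) = q u := by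
  obtain ⟨k, hk⟩ := S.exists_coinduced_lift q
  obtain ⟨h, hh⟩ := hW _ _ _ f g k hs inferInstance
  exact ⟨S.counit F ∘ₗ h.restrictScalars R, fun u => by simp [hh, hk]⟩

lemma inGorensteinClass_restrictScalars (S : FrobeniusSystem R A) (h : InGorensteinClass A M) :
    InGorensteinClass R M := by
  refine ⟨fun X => ∃ (Y : Type u) (_ : AddCommGroup Y) (_ : Module A Y) (_ : Module R Y)
    (_ : IsScalarTower R A Y), InGorensteinClass A Y ∧ Nonempty (X ≃ₗ[R] Y), ?_,
    M, _, _, _, ‹_›, h, ⟨LinearEquiv.refl R M⟩⟩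
  clear h
  rintro X ⟨Y, _, _, _, _, hY, ⟨e⟩⟩
  obtain ⟨K, P, f, g, hs, hP, hK⟩ := hY.cover
  obtain ⟨P', N, f', g', hs', hP', hN⟩ := hY.embedding
  let _ : Module R K := Module.compHom K (algebraMap R A)
  let _ : Module R P := Module.compHom P (algebraMap R A)
  let _ : Module R P' := Module.compHom P' (algebraMap R A)
  let _ : Module R N := Module.compHom N (algebraMap R A)
  have : IsScalarTower R A K := .of_algebraMap_smul fun _ _ => rfl
  have : IsScalarTower R A P := .of_algebraMap_smul fun _ _ => rfl
  have : IsScalarTower R A P' := .of_algebraMap_smul fun _ _ => rfl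
  have : IsScalarTower R A N := .of_algebraMap_smul fun _ _ => rfl
  have hPR := S.projective_restrictScalars P
  have hPR' := S.projective_restrictScalars P'
  have hX : IsShortExact (f.restrictScalars R) (e.symm.toLinearMap ∘ₗ g.restrictScalars R) :=
    ⟨hs.injective, fun v => by simp [hs.exact], e.symm.surjective.comp hs.surjective⟩
  refine ⟨extVanishesOnProjectives_of_presentation hX fun Q _ _ q _ =>
      S.exists_extension_of_extVanishes hs hY.extVanishes q,
    ⟨ModuleCat.of R P', ModuleCat.of R N, f'.restrictScalars R ∘ₗ e.toLinearMap,
      g'.restrictScalars R, ⟨hs'.injective.comp e.injective, fun v => ?_, hs'.surjective⟩, hPR',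
      N, _, _, _, ‹_›, hN, ⟨LinearEquiv.refl R N⟩⟩,
    ⟨ModuleCat.of R K, ModuleCat.of R P, _, _, hX, hPR,
      K, _, _, _, ‹_›, hK, ⟨LinearEquiv.refl R K⟩⟩⟩
  refine (hs'.exact v).trans ⟨?_, ?_⟩
  · rintro ⟨u, rfl⟩
    exact ⟨e.symm u, by simp⟩
  · rintro ⟨u, rfl⟩
    exact ⟨e u, rfl⟩

lemma extVanishes_of_restrictScalars (S : FrobeniusSystem R A) (h : ExtVanishesOnProjectives R M) :
    ExtVanishesOnProjectives A M := by
  intro U V Q _ _ _ _ _ _ f g q hs hQ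
  let _ : Module R U := Module.compHom U (algebraMap R A)
  let _ : Module R V := Module.compHom V (algebraMap R A)
  let _ : Module R Q := Module.compHom Q (algebraMap R A)
  have : IsScalarTower R A U := .of_algebraMap_smul fun _ _ => rfl
  have : IsScalarTower R A V := .of_algebraMap_smul fun _ _ => rfl
  have : IsScalarTower R A Q := .of_algebraMap_smul fun _ _ => rfl
  let m : A ⊗[R] Q →ₗ[A] Q := TensorProduct.AlgebraTensorModule.lift
    { toFun := fun x => Algebra.lsmul R R Q x
      map_add' := fun x y => by simp
      map_smul' := fun x y => by ext; simp }
  have hm : Function.Surjective m := fun x => ⟨1 ⊗ₜ x, by simp [m]⟩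
  obtain ⟨s, hsm⟩ := exists_projective_lift hm (LinearMap.id (R := A) (M := Q))
  obtain ⟨k, hk⟩ := h U V Q (f.restrictScalars R) (g.restrictScalars R)
    (S.counit Q ∘ₗ (s ∘ₗ q).restrictScalars R) hs.restrictScalars (S.projective_restrictScalars Q)
  obtain ⟨l, hl⟩ := S.exists_coinduced_lift k
  refine ⟨m ∘ₗ l, fun u => ?_⟩
  -- The R-extension k of the counit of s ∘ q lifts to l over A; m splits off Q, so m ∘ l extends q.
  have hu : l (f u) = s (q u) := S.eq_of_counit_smul fun x => by
    rw [← map_smul, ← map_smul, hl]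
    simpa using hk (x • u)
  rw [LinearMap.comp_apply, hu, hsm, LinearMap.id_apply]

lemma inGorensteinClass_of_restrictScalars (S : FrobeniusSystem R A) (h : InGorensteinClass R M) :
    InGorensteinClass A M := by
  refine ⟨fun X => ∃ (_ : Module R X) (_ : IsScalarTower R A X), InGorensteinClass R X, ?_,
    ‹Module R M›, ‹_›, h⟩
  clear h
  rintro X ⟨_, _, hX⟩
  refine ⟨S.extVanishes_of_restrictScalars hX.extVanishes, ?_, ?_⟩
  · obtain ⟨P, L, f, g, hs, hP, hL⟩ := hX.embedding
    obtain ⟨j, hj⟩ := S.exists_coinduced_lift f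
    have hjs := isShortExact_mkQ (f := j) fun x y hxy => hs.injective (by rw [← hj, hxy, hj])
    have hAP : Module.Projective R (A ⊗[R] P) := S.projective_restrictScalars _
    refine ⟨ModuleCat.of A (A ⊗[R] P), ModuleCat.of A _, _, _, hjs,
      inferInstanceAs (Module.Projective A (A ⊗[R] P)),
      inferInstanceAs (Module R ((A ⊗[R] P) ⧸ LinearMap.range j)),
      inferInstanceAs (IsScalarTower R A ((A ⊗[R] P) ⧸ LinearMap.range j)),
      .of_projective_embedding (hjs.restrictScalars (R := R)) ?_ hX⟩
    -- An R-map X → Q extends over P, as Ext¹(L, Q) = 0, and then over A ⊗ P by composing with the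
    -- counit.
    refine extVanishesOnProjectives_of_presentation (hjs.restrictScalars (R := R))
      fun Q _ _ q hQ => ?_
    obtain ⟨k, hk⟩ := hL.extVanishes _ _ _ f g q hs hQ
    exact ⟨k ∘ₗ S.counit P, fun x => by simp [hj, hk]⟩
  · have hs := isShortExact_subtype (Finsupp.linearCombination_id_surjective A X)
    have hF : Module.Projective R (X →₀ A) := S.projective_restrictScalars _
    exact ⟨ModuleCat.of A (LinearMap.ker (Finsupp.linearCombination A (id : X → X))),
      ModuleCat.of A (X →₀ A), _, _, hs, inferInstanceAs (Module.Projective A (X →₀ A)),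
      inferInstanceAs (Module R (LinearMap.ker (Finsupp.linearCombination A (id : X → X)))),
      inferInstanceAs (IsScalarTower R A
        (LinearMap.ker (Finsupp.linearCombination A (id : X → X)))),
      .of_projective_presentation (hs.restrictScalars (R := R)) hX⟩

lemma isGorensteinProjective_iff_restrictScalars (S : FrobeniusSystem R A) :
    IsGorensteinProjective A M ↔ IsGorensteinProjective R M := by
  rw [isGorensteinProjective_iff, isGorensteinProjective_iff]
  exact ⟨S.inGorensteinClass_restrictScalars, S.inGorensteinClass_of_restrictScalars⟩

end FrobeniusSystem

/-- The trace is e 1; the right basis generates A over R, and the left basis is the preimage under e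
of its coordinate forms. -/
lemma IsFrobeniusExtension.nonempty_frobeniusSystem {R A : Type u} [CommRing R] [Ring A]
    [Algebra R A] (h : IsFrobeniusExtension (algebraMap R A)) :
    Nonempty (FrobeniusSystem R A) := by
  have hmod : (algebraMap R A).toModule = Algebra.toModule :=
    Module.ext (funext₂ fun r x => (Algebra.smul_def r x).symm)
  unfold IsFrobeniusExtension at h
  rw [hmod] at h
  obtain ⟨_, _, e, he, -⟩ := h
  obtain ⟨n, f, g, -, -, hfg⟩ := Module.Finite.exists_comp_eq_id_of_projective R A
  have he1 : ∀ x y, e x y = e 1 (y * x) := fun x y => by rw [← he, mul_one]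
  have h1 : ∀ y, ∑ i, e 1 (y * e.symm (LinearMap.proj i ∘ₗ g)) • f (Pi.single i 1) = y := by
    intro y
    simp only [← he1, AddEquiv.apply_symm_apply, LinearMap.comp_apply, LinearMap.proj_apply]
    simp only [← map_smul, ← map_sum]
    conv_rhs => rw [← LinearMap.id_apply (R := R) y, ← hfg, LinearMap.comp_apply]
    congr 1
    ext i
    simp [Pi.single_apply]
  refine ⟨⟨n, e 1, fun i => e.symm (LinearMap.proj i ∘ₗ g), fun i => f (Pi.single i 1), h1,
    fun y => e.injective (LinearMap.ext fun z => ?_)⟩⟩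
  rw [he1 _ z, he1 y z, Finset.mul_sum, map_sum]
  conv_rhs => rw [← h1 z, Finset.sum_mul, map_sum]
  simp [mul_comm]

/-- The opposite of a Frobenius system. -/
def FrobeniusSystem.op {R A : Type u} [CommRing R] [Ring A] [Algebra R A]
    (S : FrobeniusSystem R A) [Algebra Rᵐᵒᵖ Aᵐᵒᵖ]
    (h : algebraMap Rᵐᵒᵖ Aᵐᵒᵖ = RingHom.op (algebraMap R A)) : FrobeniusSystem Rᵐᵒᵖ Aᵐᵒᵖ :=
  have hsmul : ∀ (r : R) (x : A), MulOpposite.op r • MulOpposite.op x = MulOpposite.op (r • x) :=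
    fun r x => by
      rw [Algebra.smul_def, h, Algebra.smul_def, Algebra.commutes]
      rfl
  { rank := S.rank
    trace :=
      { toFun := fun x => MulOpposite.op (S.trace x.unop)
        map_add' := fun x y => by simp
        map_smul' := fun r x => by
          obtain ⟨r, rfl⟩ := MulOpposite.op_surjective r
          obtain ⟨x, rfl⟩ := MulOpposite.op_surjective x
          rw [hsmul]
          simp [mul_comm] }
    -- Multiplication is reversed, so the dual bases trade places.
    left := fun i => MulOpposite.op (S.right i)
    right := fun i => MulOpposite.op (S.left i)
    sum_trace_mul_left := fun y => by
      obtain ⟨y, rfl⟩ := MulOpposite.op_surjective y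
      conv_rhs => rw [← S.sum_trace_right_mul y, Finset.op_sum]
      exact Finset.sum_congr rfl fun i _ => hsmul _ _
    sum_trace_right_mul := fun y => by
      obtain ⟨y, rfl⟩ := MulOpposite.op_surjective y
      conv_rhs => rw [← S.sum_trace_mul_left y, Finset.op_sum]
      exact Finset.sum_congr rfl fun i _ => hsmul _ _ }

end Frobenius

theorem mainTheorem8 (R A : Type u) [CommRing R] [IsNoetherianRing R] [Ring A] [Algebra R A]
    [Module.Finite R A] (hφ : IsFrobeniusExtension (algebraMap R A)) :
    HasAscentDescentGorensteinProjective (algebraMap R A) := by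
  obtain ⟨S⟩ := hφ.nonempty_frobeniusSystem
  refine ⟨fun M _ => ?_, fun M _ => ?_⟩
  · let _ : Module R M := Module.compHom M (algebraMap R A)
    have : IsScalarTower R A M := .of_algebraMap_smul fun _ _ => rfl
    have h := S.isGorensteinProjective_iff_restrictScalars (M := M)
    exact h
  · let _ : Algebra Rᵐᵒᵖ Aᵐᵒᵖ := (RingHom.op (algebraMap R A)).toAlgebra' fun r x =>
      MulOpposite.unop_injective (Algebra.commutes _ _).symm
    let _ : Module Rᵐᵒᵖ M := Module.compHom M (RingHom.op (algebraMap R A))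
    have : IsScalarTower Rᵐᵒᵖ Aᵐᵒᵖ M := .of_algebraMap_smul fun _ _ => rfl
    have h := (S.op rfl).isGorensteinProjective_iff_restrictScalars (M := M)
    exact h
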